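/- (1) Let $\mathcal{D}$ be a triangulated category with (set-indexed) coproducts, let $(\mathcal{U},\mathcal{U}^{\perp}[1])$ be a t-structure on $\mathcal{D}$ and let $\mathcal{H}=\mathcal{U}\cap\mathcal{U}^{\perp}[1]$ be its heart. Let $H:\mathcal{D}\to\mathcal{A}$ be a cohomological functor to an abelian category, put $H^{k}(X)=H(X[k])$ for $k\in\mathbb{Z}$, and let $r\in\mathbb{Z}\cup\{+\infty\}$ be such that every object $X$ of $\mathcal{H}$ with $H^{k}(X)=0$ for all integers $k<r$ is zero. Let $I$ be a small category such that $I$-colimits exist and are exact in $\mathcal{A}$. If, for each diagram $X:I\to\mathcal{H}$ and each integer $k<r$, the canonical morphism $\operatorname{colim}_I H^{k}(X_i)\to H^{k}(\operatorname{colim}_{\mathcal{H}} X_i)$ is an isomorphism, then $I$-colimits exist and are exact in the abelian category $\mathcal{H}$. (2) Let $\mathcal{G}$ be a Grothendieck category, let $(\mathcal{U},\mathcal{U}^{\perp}[1])$ be any t-structure on its (unbounded) derived category $\mathcal{D}(\mathcal{G})$ and let $\mathcal{H}=\mathcal{U}\cap\mathcal{U}^{\perp}[1]$ be its heart. If the restrictions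 $H^{m}:\mathcal{H}\to\mathcal{G}$ of the classical homology functors preserve direct limits (colimits indexed by upward directed sets) for all $m\in\mathbb{Z}$, then $\mathcal{H}$ is an AB5 abelian category, i.e. it is abelian, has coproducts, and direct limits are exact in it. -/

import Mathlib

open CategoryTheory Limits Pretriangulated Triangulated

namespace HeartAB5

universe w v v' u u'

/-- Colimits of shape `I` exist in `C` and are exact. -/
def ExactColimits (I : Type u') [Category.{v'} I] (C : Type u) [Category.{v} C] : Prop :=
  ∃ _ : HasColimitsOfShape I C, HasExactColimitsOfShape I C

/-- `C` is an AB5 abelian category, relative to the universe `w` of small sets: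
it is abelian, it has small coproducts (AB3), and small filtered colimits are exact in it. -/
structure IsAB5Abelian (C : Type u) [Category.{v} C] : Prop where
  abelian : Nonempty (Abelian C)
  hasCoproducts : HasCoproducts.{w} C
  exact : ∃ _ : HasFilteredColimitsOfSize.{w, w} C, AB5OfSize.{w, w} C

/-- The functor `F` preserves direct limits, i.e. colimits indexed by (non-empty) upward
directed ordered sets in the universe `w`. -/
def PreservesDirectLimits {C : Type u} [Category.{v} C] {C' : Type u'} [Category.{v'} C']
    (F : C ⥤ C') : Prop :=
  ∀ (J : Type w) [PartialOrder J] [IsDirectedOrder J] [Nonempty J], PreservesColimitsOfShape J F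

section

variable {D : Type u} [Category.{v} D] [Preadditive D] [HasZeroObject D] [HasShift D ℤ]
  [∀ n : ℤ, (shiftFunctor D n).Additive] [Pretriangulated D]
  {A : Type u'} [Category.{v'} A] [Abelian A]

/-- `H^k`, the functor `X ↦ H (X[k])`. -/
abbrev cohomology (H : D ⥤ A) (k : ℤ) : D ⥤ A := shiftFunctor D k ⋙ H

/-- `(H, r)`, with `r ∈ ℤ ∪ {+∞}`, is a cohomological datum with respect to the full subcategory
`P` of `D`: `H` is a cohomological functor to an abelian category, and an object `X` of `P` such
that `H^k X = 0` for all integers `k < r` is zero. -/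
structure IsCohomologicalDatum (P : ObjectProperty D) (H : D ⥤ A) (r : WithTop ℤ) : Prop where
  isHomological : H.IsHomological
  isZero (X : D) (hX : P X)
    (h : ∀ k : ℤ, (k : WithTop ℤ) < r → IsZero ((cohomology H k).obj X)) : IsZero X

end

end HeartAB5

namespace HeartAB5

universe w w' v v' u u'

/-! ### The heart of a t-structure: kernels, cokernels and coproducts. -/

section Heart

variable {D : Type u} [Category.{v} D] [Preadditive D] [HasZeroObject D] [HasShift D ℤ]
  [∀ n : ℤ, (shiftFunctor D n).Additive] [Pretriangulated D] (t : TStructure D)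

/-! The heart inherits coproducts by truncating those of `D`, so colimits exist in it and are right
exact; only preservation of monomorphisms is at stake. Let 0 → X → Y → Z → 0 be a short exact
sequence of diagrams and q : colim X → W the epimorphism onto the kernel W of colim Y → colim Z.
Connecting morphisms are natural in the heart, so the long exact sequences of the triangles form
diagrams in `A`. Their exact colimits compare with the sequence of 0 → W → colim Y → colim Z → 0,
and the five lemma makes H^k(q) invertible for k < r (`isIso_heartCohomology_map`). Hence H^k(ker q)
= 0 for k < r, so ker q = 0 and colim X → colim Y is a monomorphism.

For `DerivedCategory G`, homology detects zero objects, so r = ∞ works. Its coproducts are computed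
degreewise because coproducts in `G` are exact, and filtered colimits reduce to directed ones along
final functors. -/

instance isLE_obj_heart (X : t.heart.FullSubcategory) : t.IsLE X.obj 0 := ⟨X.property.1⟩

instance isGE_obj_heart (X : t.heart.FullSubcategory) : t.IsGE X.obj 0 := ⟨X.property.2⟩

instance isTriangulatedClosed₂_heart : t.heart.IsTriangulatedClosed₂ :=
  .mk' fun T hT h₁ h₃ ↦ by
    rw [t.mem_heart_iff] at h₁ h₃ ⊢
    exact ⟨t.isLE₂ T hT 0 h₁.1 h₃.1, t.isGE₂ T hT 0 h₁.2 h₃.2⟩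

instance containsZero_heart : t.heart.ContainsZero :=
  ⟨⟨_, isZero_zero D, (t.mem_heart_iff _).2 ⟨inferInstance, inferInstance⟩⟩⟩

instance isClosedUnderBinaryProducts_heart : t.heart.IsClosedUnderBinaryProducts where
  limitsOfShape_le := by
    rintro X ⟨p⟩
    refine t.heart.prop_of_iso ?_ (t.heart.ext_of_isTriangulatedClosed₂ _
      (binaryProductTriangle_distinguished _ _)
      (p.prop_diag_obj (.mk .left)) (p.prop_diag_obj (.mk .right)))
    exact IsLimit.conePointUniqueUpToIso (prodIsProd _ _)
      ((IsLimit.postcomposeHomEquiv (diagramIsoPair p.diag) _).2 p.isLimit)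

instance isClosedUnderFiniteProducts_heart : t.heart.IsClosedUnderFiniteProducts := .mk'

instance hasFiniteProducts_heart : HasFiniteProducts t.heart.FullSubcategory :=
  ⟨fun _ ↦ inferInstance⟩

lemma heart_hom_shift_neg_eq_zero ⦃X Y : t.heart.FullSubcategory⦄ ⦃n : ℤ⦄
    (f : t.heart.ι.obj X ⟶ (t.heart.ι.obj Y)⟦n⟧) (hn : n < 0) : f = 0 := by
  have : t.IsGE (Y.obj⟦n⟧) (-n) := t.isGE_shift Y.obj 0 n (-n)
  exact t.zero_of_isLE_of_isGE f 0 (-n) (by lia) (isLE_obj_heart t X) this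

lemma distinguished_of_iso_obj₁ {X X' Y Z : D} {f : X ⟶ Y} {g : Y ⟶ Z} {h : Z ⟶ X⟦(1 : ℤ)⟧}
    (hT : Triangle.mk f g h ∈ distTriang D) (e : X' ≅ X) :
    Triangle.mk (e.hom ≫ f) g (h ≫ e.inv⟦(1 : ℤ)⟧') ∈ distTriang D :=
  isomorphic_distinguished _ hT _
    (Triangle.isoMk (Triangle.mk (e.hom ≫ f) g (h ≫ e.inv⟦(1 : ℤ)⟧')) (Triangle.mk f g h)
      e (Iso.refl Y) (Iso.refl Z) (Category.comp_id _)
      ((Category.comp_id g).trans (Category.id_comp g).symm) (by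
        change (h ≫ e.inv⟦(1 : ℤ)⟧') ≫ e.hom⟦(1 : ℤ)⟧' = 𝟙 Z ≫ h
        rw [Category.assoc, ← Functor.map_comp, e.inv_hom_id, CategoryTheory.Functor.map_id,
          Category.comp_id, Category.id_comp]))

/-- A morphism between the first two edges of distinguished triangles with objects in the heart
is compatible with the connecting morphisms. -/
lemma comp_mor₃_eq_of_heart {T T' : Triangle D} (hT : T ∈ distTriang D) (hT' : T' ∈ distTriang D)
    (h₁ : t.IsLE T.obj₁ 0) (h₃ : t.IsGE T'.obj₃ 0)
    (a : T.obj₁ ⟶ T'.obj₁) (b : T.obj₂ ⟶ T'.obj₂) (c : T.obj₃ ⟶ T'.obj₃)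
    (hab : T.mor₁ ≫ b = a ≫ T'.mor₁) (hbc : T.mor₂ ≫ c = b ≫ T'.mor₂) :
    T.mor₃ ≫ a⟦(1 : ℤ)⟧' = c ≫ T'.mor₃ := by
  obtain ⟨c', h₂, h₃'⟩ := complete_distinguished_triangle_morphism T T' hT hT' a b hab
  -- Two fillers differ by a map factoring through `T.obj₁⟦1⟧`, which lies in degrees ≤ -1 and so
  -- has no nonzero map to `T'.obj₃`.
  obtain ⟨d, hd⟩ := Triangle.yoneda_exact₃ T hT (c - c') (by
    rw [Preadditive.comp_sub, hbc, h₂, sub_self])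
  have : t.IsLE (T.obj₁⟦(1 : ℤ)⟧) (-1) := t.isLE_shift T.obj₁ 0 1 (-1)
  rw [t.zero d (-1) 0, comp_zero, sub_eq_zero] at hd
  rw [hd, h₃']

/-- The aisle is a left orthogonal, which coproducts respect; the coaisle need not be closed under
them, hence the truncation in `heartCofan`. -/
lemma isLE_sigma {J : Type w} (Y : J → D) [HasCoproduct Y] (n : ℤ) (hY : ∀ j, t.IsLE (Y j) n) :
    t.IsLE (∐ Y) n := by
  rw [t.isLE_iff_orthogonal n (n + 1) rfl]
  intro Z f hZ
  ext j
  have := hY j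
  rw [t.zero (Sigma.ι Y j ≫ f) n (n + 1), comp_zero]

variable [IsTriangulated D]

/-- The cone of a morphism of the heart lives in degrees -1 and 0. Its truncation triangle exhibits
the shifted kernel and the cokernel. -/
lemma admissibleMorphism_heart_eq_top :
    AbelianSubcategory.admissibleMorphism t.heart.ι = ⊤ := by
  ext X₁ X₂ f
  simp only [MorphismProperty.top_apply, iff_true]
  intro X₃ f₂ f₃ hT
  have hLE : t.IsLE X₃ 0 := t.isLE₂ _ (rot_of_distTriang _ hT) 0 (isLE_obj_heart t X₂) (by
    have : t.IsLE (X₁.obj⟦(1 : ℤ)⟧) (-1) := t.isLE_shift X₁.obj 0 1 (-1)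
    exact t.isLE_of_le (X₁.obj⟦(1 : ℤ)⟧) (-1) 0)
  have hGE : t.IsGE X₃ (-1) := t.isGE₂ _ (rot_of_distTriang _ hT) (-1)
    (t.isGE_of_ge X₂.obj (-1) 0) (t.isGE_shift X₁.obj 0 1 (-1))
  have hQ : t.heart ((t.truncGE 0).obj X₃) :=
    (t.mem_heart_iff _).2 ⟨inferInstance, inferInstance⟩
  have hLE' : t.IsLE ((t.truncLT 0).obj X₃) (-1) := t.isLE_truncLT_obj X₃ 0 (-1)
  have hK : t.heart (((t.truncLT 0).obj X₃)⟦(-1 : ℤ)⟧) :=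
    (t.mem_heart_iff _).2 ⟨t.isLE_shift _ (-1) (-1) 0, t.isGE_shift _ (-1) (-1) 0⟩
  let e : ((t.truncLT 0).obj X₃)⟦(-1 : ℤ)⟧⟦(1 : ℤ)⟧ ≅ (t.truncLT 0).obj X₃ :=
    (shiftEquiv D (1 : ℤ)).counitIso.app _
  refine ⟨⟨_, hK⟩, ⟨_, hQ⟩, e.hom ≫ (t.truncLTι 0).app X₃, (t.truncGEπ 0).app X₃,
    (t.truncGEδLT 0).app X₃ ≫ e.inv⟦(1 : ℤ)⟧', ?_⟩
  exact distinguished_of_iso_obj₁ (t.triangleLTGE_distinguished 0 X₃) e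

/-- The heart of a t-structure on a triangulated category is an abelian category. -/
noncomputable abbrev abelianHeart : Abelian t.heart.FullSubcategory :=
  AbelianSubcategory.abelian t.heart.ι (heart_hom_shift_neg_eq_zero t)
    (admissibleMorphism_heart_eq_top t)

lemma exists_distinguished_of_epi_of_isLimit
    {X₁ X₂ X₃ : t.heart.FullSubcategory} (f : X₁ ⟶ X₂) (g : X₂ ⟶ X₃) [Epi g] (w : f ≫ g = 0)
    (h : IsLimit (KernelFork.ofι f w)) :
    ∃ δ : X₃.obj ⟶ X₁.obj⟦(1 : ℤ)⟧, Triangle.mk f.hom g.hom δ ∈ distTriang D := by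
  obtain ⟨K, i, δ, hT⟩ := AbelianSubcategory.exists_distinguished_triangle_of_epi
    (heart_hom_shift_neg_eq_zero t) (admissibleMorphism_heart_eq_top t) g
  let e := IsLimit.conePointUniqueUpToIso h
    (AbelianSubcategory.isLimitKernelForkOfDistTriang (heart_hom_shift_neg_eq_zero t) i g δ hT)
  have he : e.hom ≫ i = f := IsLimit.conePointUniqueUpToIso_hom_comp _ _ WalkingParallelPair.zero
  have := distinguished_of_iso_obj₁ hT (t.heart.ι.mapIso e)
  rw [Functor.mapIso_hom, ← Functor.map_comp, he] at this
  exact ⟨_, this⟩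

section Coproducts

variable {J : Type w} (X : J → t.heart.FullSubcategory) [HasCoproduct fun j ↦ (X j).obj]

instance : t.IsLE (∐ fun j ↦ (X j).obj) 0 := isLE_sigma t _ 0 fun _ ↦ inferInstance

/-- The coproduct in the heart: the truncation of the coproduct in the ambient category. -/
noncomputable def heartCofan : Cofan X :=
  Cofan.mk (⟨(t.truncGE 0).obj (∐ fun j ↦ (X j).obj),
    (t.mem_heart_iff _).2 ⟨inferInstance, inferInstance⟩⟩ : t.heart.FullSubcategory)
    fun j ↦ ObjectProperty.homMk (Sigma.ι (fun j ↦ (X j).obj) j ≫ (t.truncGEπ 0).app _)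

/-- `heartCofan` is a coproduct. -/
noncomputable def isColimitHeartCofan : IsColimit (heartCofan t X) :=
  Cofan.IsColimit.mk _ (fun s ↦ ObjectProperty.homMk
      (t.descTruncGE (Sigma.desc fun j ↦ (s.inj j).hom) 0))
    (fun s j ↦ by
      ext
      simp [heartCofan])
    (fun s m hm ↦ by
      ext
      refine t.from_truncGE_obj_ext ?_
      refine (Sigma.hom_ext _ _ fun j ↦ ?_).trans (t.π_descTruncGE _ 0).symm
      rw [Sigma.ι_desc]
      exact (Category.assoc _ _ _).symm.trans (congr_arg InducedCategory.Hom.hom (hm j)))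

instance hasCoproducts_heart [HasCoproducts.{w} D] : HasCoproducts.{w} t.heart.FullSubcategory :=
  hasCoproducts_of_colimit_cofans (fun X ↦ heartCofan t X) (fun X ↦ isColimitHeartCofan t X)

end Coproducts

end Heart

/-! ### Long exact sequences of diagrams and preservation of monomorphisms. -/

section Criterion

variable {D : Type u} [Category.{v} D] [Preadditive D] [HasZeroObject D] [HasShift D ℤ]
  [∀ n : ℤ, (shiftFunctor D n).Additive] [Pretriangulated D] (t : TStructure D)
  {A : Type u'} [Category.{v'} A] [Abelian A] (H : D ⥤ A) [H.IsHomological] [H.ShiftSequence ℤ]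

/-- The restriction to the heart of the cohomology functor in degree `k`. -/
abbrev heartCohomology (k : ℤ) : t.heart.FullSubcategory ⥤ A := t.heart.ι ⋙ H.shift k

/-- Short complexes in a functor category that are exact at every object are exact. -/
lemma exact_of_evaluation {I : Type*} [Category* I] (S : ShortComplex (I ⥤ A))
    (h : ∀ i, (S.map ((evaluation I A).obj i)).Exact) : S.Exact := by
  rw [ShortComplex.exact_iff_isZero_homology, Functor.isZero_iff]
  intro i
  exact ((ShortComplex.exact_iff_isZero_homology _).1 (h i)).of_iso
    (S.mapHomologyIso ((evaluation I A).obj i)).symm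

lemma exact_mk₄ {X₀ X₁ X₂ X₃ X₄ : A} {a : X₀ ⟶ X₁} {b : X₁ ⟶ X₂} {c : X₂ ⟶ X₃} {d : X₃ ⟶ X₄}
    {ab : a ≫ b = 0} {bc : b ≫ c = 0} {cd : c ≫ d = 0}
    (h₁ : (ShortComplex.mk a b ab).Exact) (h₂ : (ShortComplex.mk b c bc).Exact)
    (h₃ : (ShortComplex.mk c d cd).Exact) : (ComposableArrows.mk₄ a b c d).Exact :=
  ComposableArrows.exact_of_δ₀ h₁.exact_toComposableArrows
    (ComposableArrows.exact_of_δ₀ h₂.exact_toComposableArrows h₃.exact_toComposableArrows)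

/-- The five lemma for two exact sequences which only differ in the middle. -/
lemma isIso_of_exact_of_exact {X₀ X₁ X₂ X₂' X₃ X₄ : A} {a : X₀ ⟶ X₁} {b : X₁ ⟶ X₂} {c : X₂ ⟶ X₃}
    {d : X₃ ⟶ X₄} {b' : X₁ ⟶ X₂'} {c' : X₂' ⟶ X₃}
    (h : (ComposableArrows.mk₄ a b c d).Exact) (h' : (ComposableArrows.mk₄ a b' c' d).Exact)
    (q : X₂ ⟶ X₂') (hb : b ≫ q = b') (hc : q ≫ c' = c) : IsIso q := by
  let φ : ComposableArrows.mk₄ a b c d ⟶ ComposableArrows.mk₄ a b' c' d :=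
    ComposableArrows.homMk₄ (𝟙 X₀) (𝟙 X₁) q (𝟙 X₃) (𝟙 X₄)
      ((Category.comp_id a).trans (Category.id_comp a).symm)
      (hb.trans (Category.id_comp b').symm) ((Category.comp_id c).trans hc.symm)
      ((Category.comp_id d).trans (Category.id_comp d).symm)
  exact Abelian.isIso_of_epi_of_isIso_of_isIso_of_mono h h' φ
    (inferInstanceAs (Epi (𝟙 X₀))) (inferInstanceAs (IsIso (𝟙 X₁)))
    (inferInstanceAs (IsIso (𝟙 X₃))) (inferInstanceAs (Mono (𝟙 X₄)))

variable [IsTriangulated D]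

attribute [local instance] abelianHeart

lemma exists_distinguished_of_shortExact {S : ShortComplex t.heart.FullSubcategory}
    (hS : S.ShortExact) :
    ∃ δ : S.X₃.obj ⟶ S.X₁.obj⟦(1 : ℤ)⟧, Triangle.mk S.f.hom S.g.hom δ ∈ distTriang D :=
  have := hS.epi_g
  exists_distinguished_of_epi_of_isLimit t S.f S.g S.zero hS.fIsKernel

section

variable {I : Type*} [Category* I] {S : ShortComplex (I ⥤ t.heart.FullSubcategory)}

/-- The connecting natural transformation of the long exact cohomology sequence of a short exact
sequence of diagrams in the heart. -/
noncomputable def diagramδ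
    (δ : ∀ i, (S.X₃.obj i).obj ⟶ (S.X₁.obj i).obj⟦(1 : ℤ)⟧)
    (hδ : ∀ i, Triangle.mk (S.f.app i).hom (S.g.app i).hom (δ i) ∈ distTriang D)
    (k₀ k₁ : ℤ) (hk : k₀ + 1 = k₁) :
    S.X₃ ⋙ heartCohomology t H k₀ ⟶ S.X₁ ⋙ heartCohomology t H k₁ where
  app i := H.homologySequenceδ (Triangle.mk (S.f.app i).hom (S.g.app i).hom (δ i)) k₀ k₁ hk
  naturality i j φ := by
    have h₁ : (S.f.app i).hom ≫ (S.X₂.map φ).hom = (S.X₁.map φ).hom ≫ (S.f.app j).hom :=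
      congr_arg InducedCategory.Hom.hom (S.f.naturality φ).symm
    have h₂ : (S.g.app i).hom ≫ (S.X₃.map φ).hom = (S.X₂.map φ).hom ≫ (S.g.app j).hom :=
      congr_arg InducedCategory.Hom.hom (S.g.naturality φ).symm
    exact H.homologySequenceδ_naturality
      (Triangle.mk (S.f.app i).hom (S.g.app i).hom (δ i))
      (Triangle.mk (S.f.app j).hom (S.g.app j).hom (δ j))
      { hom₁ := (S.X₁.map φ).hom
        hom₂ := (S.X₂.map φ).hom
        hom₃ := (S.X₃.map φ).hom
        comm₁ := h₁
        comm₂ := h₂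
        comm₃ := comp_mor₃_eq_of_heart t (hδ i) (hδ j) (isLE_obj_heart t (S.X₁.obj i))
          (isGE_obj_heart t (S.X₃.obj j)) _ _ _ h₁ h₂ } k₀ k₁ hk

/-- If the cohomology functors in degrees `k - 1` and `k` commute with `I`-colimits, the
cohomology in degree `k` does not see the difference between the colimit of the left terms of a
diagram of short exact sequences and the kernel of the map between the colimits of the middle and
the right terms. -/
lemma isIso_heartCohomology_map [HasColimitsOfShape I A] [HasExactColimitsOfShape I A]
    (δ : ∀ i, (S.X₃.obj i).obj ⟶ (S.X₁.obj i).obj⟦(1 : ℤ)⟧)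
    (hδ : ∀ i, Triangle.mk (S.f.app i).hom (S.g.app i).hom (δ i) ∈ distTriang D)
    {c₁ : Cocone S.X₁} (hc₁ : IsColimit c₁) {c₂ : Cocone S.X₂} (hc₂ : IsColimit c₂)
    {c₃ : Cocone S.X₃} (hc₃ : IsColimit c₃)
    {p : c₁.pt ⟶ c₂.pt} (hp : ∀ i, c₁.ι.app i ≫ p = S.f.app i ≫ c₂.ι.app i)
    {g : c₂.pt ⟶ c₃.pt} (hg : ∀ i, c₂.ι.app i ≫ g = S.g.app i ≫ c₃.ι.app i)
    {W : t.heart.FullSubcategory} {q : c₁.pt ⟶ W} {j : W ⟶ c₂.pt} (hqj : q ≫ j = p)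
    {w : j ≫ g = 0} (hW : (ShortComplex.mk j g w).ShortExact)
    (k₀ k₁ : ℤ) (hk : k₀ + 1 = k₁)
    [PreservesColimitsOfShape I (heartCohomology t H k₀)]
    [PreservesColimitsOfShape I (heartCohomology t H k₁)] :
    IsIso ((heartCohomology t H k₁).map q) := by
  obtain ⟨δ', hδ'⟩ := exists_distinguished_of_shortExact t hW
  let F₀ := heartCohomology t H k₀
  let F₁ := heartCohomology t H k₁
  have hp' (i : I) : F₁.map (c₁.ι.app i) ≫ F₁.map p = F₁.map (S.f.app i) ≫ F₁.map (c₂.ι.app i) := by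
    rw [← F₁.map_comp, hp, F₁.map_comp]
  have hg₀ (i : I) : F₀.map (c₂.ι.app i) ≫ F₀.map g = F₀.map (S.g.app i) ≫ F₀.map (c₃.ι.app i) := by
    rw [← F₀.map_comp, hg, F₀.map_comp]
  have hg₁ (i : I) : F₁.map (c₂.ι.app i) ≫ F₁.map g = F₁.map (S.g.app i) ≫ F₁.map (c₃.ι.app i) := by
    rw [← F₁.map_comp, hg, F₁.map_comp]
  let d := diagramδ t H δ hδ k₀ k₁ hk
  let dc : F₀.obj c₃.pt ⟶ F₁.obj c₁.pt :=
    (isColimitOfPreserves F₀ hc₃).map (F₁.mapCocone c₁) d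
  have hdc (i : I) : F₀.map (c₃.ι.app i) ≫ dc = d.app i ≫ F₁.map (c₁.ι.app i) :=
    (isColimitOfPreserves F₀ hc₃).ι_map (F₁.mapCocone c₁) d i
  let dW : F₀.obj c₃.pt ⟶ F₁.obj W :=
    H.homologySequenceδ (Triangle.mk j.hom g.hom δ') k₀ k₁ hk
  -- The colimit of the connecting maps agrees with the connecting map of the limit sequence: on
  -- each component, `comp_mor₃_eq_of_heart` supplies the missing square of a morphism of triangles.
  have hdW : dc ≫ F₁.map q = dW := by
    refine (isColimitOfPreserves F₀ hc₃).hom_ext fun i ↦ ?_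
    change F₀.map (c₃.ι.app i) ≫ dc ≫ F₁.map q = F₀.map (c₃.ι.app i) ≫ dW
    rw [← Category.assoc, hdc, Category.assoc, ← F₁.map_comp]
    have h₁ : (S.f.app i).hom ≫ (c₂.ι.app i).hom = (c₁.ι.app i ≫ q).hom ≫ j.hom := by
      have := congr_arg InducedCategory.Hom.hom (hp i)
      rw [← hqj, ← Category.assoc] at this
      exact this.symm
    have h₂ : (S.g.app i).hom ≫ (c₃.ι.app i).hom = (c₂.ι.app i).hom ≫ g.hom :=
      congr_arg InducedCategory.Hom.hom (hg i).symm
    exact (H.homologySequenceδ_naturality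
      (Triangle.mk (S.f.app i).hom (S.g.app i).hom (δ i)) (Triangle.mk j.hom g.hom δ')
      { hom₁ := (c₁.ι.app i ≫ q).hom
        hom₂ := (c₂.ι.app i).hom
        hom₃ := (c₃.ι.app i).hom
        comm₁ := h₁
        comm₂ := h₂
        comm₃ := comp_mor₃_eq_of_heart t (hδ i) hδ' (isLE_obj_heart t (S.X₁.obj i))
          (isGE_obj_heart t c₃.pt) _ _ _ h₁ h₂ } k₀ k₁ hk).symm
  let S₀ : ShortComplex (I ⥤ A) := ShortComplex.mk (Functor.whiskerRight S.g F₀) d (by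
    ext i
    exact H.comp_homologySequenceδ _ (hδ i) k₀ k₁ hk)
  let S₁ : ShortComplex (I ⥤ A) := ShortComplex.mk d (Functor.whiskerRight S.f F₁) (by
    ext i
    exact H.homologySequenceδ_comp _ (hδ i) k₀ k₁ hk)
  let S₂ : ShortComplex (I ⥤ A) :=
    ShortComplex.mk (Functor.whiskerRight S.f F₁) (Functor.whiskerRight S.g F₁) (by
      ext i
      exact H.homologySequence_comp _ (hδ i) k₁)
  have hS₀ : S₀.Exact := exact_of_evaluation _
    fun i ↦ H.homologySequence_exact₃ _ (hδ i) k₀ k₁ hk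
  have hS₁ : S₁.Exact := exact_of_evaluation _
    fun i ↦ H.homologySequence_exact₁ _ (hδ i) k₀ k₁ hk
  have hS₂ : S₂.Exact := exact_of_evaluation _
    fun i ↦ H.homologySequence_exact₂ _ (hδ i) k₁
  have ex₀ := colim.exact_mapShortComplex hS₀ (isColimitOfPreserves F₀ hc₂)
    (isColimitOfPreserves F₀ hc₃) (isColimitOfPreserves F₁ hc₁) (F₀.map g) dc hg₀ hdc
  have ex₁ := colim.exact_mapShortComplex hS₁ (isColimitOfPreserves F₀ hc₃)
    (isColimitOfPreserves F₁ hc₁) (isColimitOfPreserves F₁ hc₂) dc (F₁.map p) hdc hp'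
  have ex₂ := colim.exact_mapShortComplex hS₂ (isColimitOfPreserves F₁ hc₁)
    (isColimitOfPreserves F₁ hc₂) (isColimitOfPreserves F₁ hc₃) (F₁.map p) (F₁.map g) hp' hg₁
  exact isIso_of_exact_of_exact (exact_mk₄ ex₀ ex₁ ex₂)
    (exact_mk₄ (H.homologySequence_exact₃ _ hδ' k₀ k₁ hk) (H.homologySequence_exact₁ _ hδ' k₀ k₁ hk)
      (H.homologySequence_exact₂ _ hδ' k₁)) (F₁.map q) hdW
    ((F₁.map_comp q j).symm.trans (congr_arg F₁.map hqj))

end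

/-- The epimorphism in degree `k₀` kills the connecting map into H^k₁(K), the monomorphism in degree
`k₁` kills the map out of it, and the sequence is exact there. -/
lemma isZero_heartCohomology_obj {K L W : t.heart.FullSubcategory} {i : K ⟶ L} {q : L ⟶ W}
    {w : i ≫ q = 0} (h : (ShortComplex.mk i q w).ShortExact) (k₀ k₁ : ℤ) (hk : k₀ + 1 = k₁)
    [Epi ((heartCohomology t H k₀).map q)] [Mono ((heartCohomology t H k₁).map q)] :
    IsZero ((heartCohomology t H k₁).obj K) := by
  obtain ⟨δ, hδ⟩ := exists_distinguished_of_shortExact t h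
  have h₀ := (H.homologySequence_epi_shift_map_mor₂_iff _ hδ k₀ k₁ hk).1
    (inferInstanceAs (Epi ((heartCohomology t H k₀).map q)))
  have h₁ := (H.homologySequence_mono_shift_map_mor₂_iff _ hδ k₁).1
    (inferInstanceAs (Mono ((heartCohomology t H k₁).map q)))
  exact (H.homologySequence_exact₁ _ hδ k₀ k₁ hk).isZero_of_both_zeros h₀ h₁

variable {I : Type*} [Category* I] [HasColimitsOfShape I t.heart.FullSubcategory]
  [HasColimitsOfShape I A] [HasExactColimitsOfShape I A]

/-- If sufficiently many cohomology functors commute with `I`-colimits in the heart and detect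
zero objects of the heart, then `I`-colimits in the heart preserve monomorphisms. -/
lemma preservesMonomorphisms_colim_heart (r : WithTop ℤ)
    (hr : ∀ X : t.heart.FullSubcategory,
      (∀ k : ℤ, (k : WithTop ℤ) < r → IsZero ((heartCohomology t H k).obj X)) → IsZero X)
    (hI : ∀ k : ℤ, (k : WithTop ℤ) < r → PreservesColimitsOfShape I (heartCohomology t H k)) :
    (colim (J := I) (C := t.heart.FullSubcategory)).PreservesMonomorphisms where
  preserves {X Y} f hf := by
    let S := ShortComplex.mk f (cokernel.π f) (cokernel.condition f)
    have hS : S.ShortExact :=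
      { exact := ShortComplex.exact_cokernel f
        mono_f := hf
        epi_g := inferInstanceAs (Epi (cokernel.π f)) }
    have hSi (i : I) := exists_distinguished_of_shortExact t
      (hS.map_of_exact ((evaluation I t.heart.FullSubcategory).obj i))
    choose δ hδ using hSi
    have hepi : Epi (colim.map S.g) := inferInstance
    have hex : (S.map colim).Exact :=
      hS.exact.map_of_epi_of_preservesCokernel colim hS.epi_g inferInstance
    let p : colimit X ⟶ colimit Y := colim.map f
    let g : colimit Y ⟶ colimit S.X₃ := colim.map S.g
    let q : colimit X ⟶ kernel g := kernel.lift g p (S.map colim).zero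
    have hq : Epi q := (S.map colim).exact_iff_epi_kernel_lift.1 hex
    have hW : (ShortComplex.mk (kernel.ι g) g (kernel.condition g)).ShortExact :=
      { exact := ShortComplex.exact_kernel g
        mono_f := inferInstance
        epi_g := hepi }
    have hK : (ShortComplex.mk (kernel.ι q) q (kernel.condition q)).ShortExact :=
      { exact := ShortComplex.exact_kernel q
        mono_f := inferInstance
        epi_g := hq }
    have hiso (k : ℤ) (hk : (k : WithTop ℤ) < r) : IsIso ((heartCohomology t H k).map q) := by
      -- The five lemma also needs degree k - 1, which is available because the bound is only from
      -- above.
      have hk' : ((k - 1 : ℤ) : WithTop ℤ) < r :=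
        lt_of_le_of_lt (WithTop.coe_le_coe.2 (by lia)) hk
      have := hI _ hk
      have := hI _ hk'
      exact isIso_heartCohomology_map t H δ hδ (colimit.isColimit X) (colimit.isColimit Y)
        (colimit.isColimit S.X₃) (fun i ↦ ι_colimMap f i) (fun i ↦ ι_colimMap S.g i)
        (kernel.lift_ι g p _) hW (k - 1) k (by lia)
    have hzero : IsZero (kernel q) := hr _ fun k hk ↦ by
      have := hiso k hk
      have := hiso (k - 1) (lt_of_le_of_lt (WithTop.coe_le_coe.2 (by lia)) hk)
      exact isZero_heartCohomology_obj t H hK (k - 1) k (by lia)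
    have hmono : Mono q := Preadditive.mono_of_kernel_zero (hzero.eq_zero_of_src _)
    have : p = q ≫ kernel.ι g := (kernel.lift_ι g p _).symm
    change Mono p
    rw [this]
    infer_instance

end Criterion

/-! ### Exact colimits in the heart. -/

section

variable {D : Type u} [Category.{v} D] [Preadditive D] [HasZeroObject D] [HasShift D ℤ]
  [∀ n : ℤ, (shiftFunctor D n).Additive] [Pretriangulated D] [IsTriangulated D]
  {A : Type u'} [Category.{v'} A] [Abelian A]

attribute [local instance] abelianHeart

instance hasColimitsOfSize_heart [HasCoproducts.{w} D] (t : TStructure D) :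
    HasColimitsOfSize.{w, w} t.heart.FullSubcategory :=
  has_colimits_of_hasCoequalizers_and_coproducts

/-- Let `(H, r)` be a cohomological datum for the heart of a t-structure on a triangulated category
with coproducts. If `I`-colimits are exact in the target of `H` and commute with the functors
`H^k` on the heart for `k < r`, then `I`-colimits are exact in the heart. -/
theorem exactColimits_heart [HasCoproducts.{w} D] (t : TStructure D) (H : D ⥤ A) (r : WithTop ℤ)
    (I : Type w) [Category.{w} I] (hH : IsCohomologicalDatum t.heart H r)
    (hA : ExactColimits I A)
    (hI : ∀ k : ℤ, (k : WithTop ℤ) < r →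
      PreservesColimitsOfShape I (t.heart.ι ⋙ cohomology H k)) :
    ExactColimits I t.heart.FullSubcategory := by
  obtain ⟨_, _⟩ := hA
  have := hH.isHomological
  -- With this choice `H.shift k` is `cohomology H k` by definition, so the hypotheses apply
  -- verbatim.
  let := Functor.ShiftSequence.tautological H ℤ
  have := preservesMonomorphisms_colim_heart t H (I := I) r
    (fun X hX ↦ (IsZero.iff_id_eq_zero X).2 (by
      ext
      exact (hH.isZero X.obj X.property hX).eq_of_src _ _)) hI
  exact ⟨inferInstance, hasExactColimitsOfShape_of_preservesMono _ I⟩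

end

/-! ### Coproducts in the derived category. -/

section Derived

variable {G : Type u} [Category.{v} G] [Abelian G] {α : Type w}

/-- A family of cochain complexes, as a cochain complex in the category of families. -/
@[simps]
def familyComplex (K : α → CochainComplex G ℤ) : CochainComplex (Discrete α ⥤ G) ℤ where
  X n := Discrete.functor fun i ↦ (K i).X n
  d n m := Discrete.natTrans fun i ↦ (K i.as).d n m
  shape n m h := by
    ext ⟨i⟩
    exact (K i).shape n m h
  d_comp_d' n m l _ _ := by
    ext ⟨i⟩
    exact (K i).d_comp_d n m l

/-- A family of morphisms of cochain complexes, as a morphism of complexes of families. -/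
@[simps]
def familyMap {K L : α → CochainComplex G ℤ} (φ : ∀ i, K i ⟶ L i) :
    familyComplex K ⟶ familyComplex L where
  f n := Discrete.natTrans fun i ↦ (φ i.as).f n
  comm' n m _ := by
    ext ⟨i⟩
    exact (φ i).comm n m

lemma quasiIso_familyMap {K L : α → CochainComplex G ℤ} (φ : ∀ i, K i ⟶ L i)
    (hφ : ∀ i, QuasiIso (φ i)) : QuasiIso (familyMap φ) := by
  rw [HomologicalComplex.quasiIso_iff_evaluation]
  exact fun i ↦ hφ i.as

variable [HasColimitsOfShape (Discrete α) G]

/-- The degreewise coproduct of a family of cochain complexes. -/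
noncomputable def sigmaComplex (K : α → CochainComplex G ℤ) : CochainComplex G ℤ :=
  ((colim (J := Discrete α) (C := G)).mapHomologicalComplex _).obj (familyComplex K)

/-- The map induced on degreewise coproducts by a family of morphisms. -/
noncomputable def sigmaMap {K L : α → CochainComplex G ℤ} (φ : ∀ i, K i ⟶ L i) :
    sigmaComplex K ⟶ sigmaComplex L :=
  ((colim (J := Discrete α) (C := G)).mapHomologicalComplex _).map (familyMap φ)

lemma quasiIso_sigmaMap [HasExactColimitsOfShape (Discrete α) G]
    {K L : α → CochainComplex G ℤ} (φ : ∀ i, K i ⟶ L i) (hφ : ∀ i, QuasiIso (φ i)) :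
    QuasiIso (sigmaMap φ) := by
  have := quasiIso_familyMap φ hφ
  have : (colim (J := Discrete α) (C := G)).PreservesHomology :=
    Functor.preservesHomologyOfExact _
  exact HomologicalComplex.quasiIso_map_of_preservesHomology (familyMap φ) colim

/-- The inclusions in degree `n`. -/
noncomputable def sigmaInjX (K : α → CochainComplex G ℤ) (i : α) (n : ℤ) :
    (K i).X n ⟶ (sigmaComplex K).X n :=
  colimit.ι ((familyComplex K).X n) ⟨i⟩

lemma sigmaX_hom_ext {K : α → CochainComplex G ℤ} {n : ℤ} {Z : G}
    {f g : (sigmaComplex K).X n ⟶ Z} (h : ∀ i, sigmaInjX K i n ≫ f = sigmaInjX K i n ≫ g) :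
    f = g :=
  colimit.hom_ext fun i ↦ h i.as

/-- Morphisms out of the degree `n` part of a coproduct of complexes. -/
noncomputable def sigmaDescX {K : α → CochainComplex G ℤ} {n : ℤ} {Z : G}
    (f : ∀ i, (K i).X n ⟶ Z) : (sigmaComplex K).X n ⟶ Z :=
  colimit.desc ((familyComplex K).X n) (Cofan.mk Z f)

lemma sigmaInjX_desc {K : α → CochainComplex G ℤ} {n : ℤ} {Z : G}
    (f : ∀ i, (K i).X n ⟶ Z) (i : α) : sigmaInjX K i n ≫ sigmaDescX f = f i :=
  colimit.ι_desc (Cofan.mk Z f) ⟨i⟩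

lemma sigmaInjX_d (K : α → CochainComplex G ℤ) (i : α) (n m : ℤ) :
    sigmaInjX K i n ≫ (sigmaComplex K).d n m = (K i).d n m ≫ sigmaInjX K i m :=
  ι_colimMap ((familyComplex K).d n m) ⟨i⟩

lemma sigmaInjX_map {K L : α → CochainComplex G ℤ} (φ : ∀ i, K i ⟶ L i) (i : α) (n : ℤ) :
    sigmaInjX K i n ≫ (sigmaMap φ).f n = (φ i).f n ≫ sigmaInjX L i n :=
  ι_colimMap ((familyMap φ).f n) ⟨i⟩

/-- The inclusions in a coproduct of complexes. -/
@[simps]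
noncomputable def sigmaInj (K : α → CochainComplex G ℤ) (i : α) : K i ⟶ sigmaComplex K where
  f n := sigmaInjX K i n
  comm' n m _ := sigmaInjX_d K i n m

/-- Morphisms out of a coproduct of complexes. -/
@[simps]
noncomputable def sigmaDesc {K : α → CochainComplex G ℤ} {L : CochainComplex G ℤ}
    (φ : ∀ i, K i ⟶ L) : sigmaComplex K ⟶ L where
  f n := sigmaDescX fun i ↦ (φ i).f n
  comm' n m _ := sigmaX_hom_ext fun i ↦ by
    rw [← Category.assoc, sigmaInjX_desc, ← Category.assoc, sigmaInjX_d, Category.assoc,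
      sigmaInjX_desc, (φ i).comm]

lemma sigmaInj_desc {K : α → CochainComplex G ℤ} {L : CochainComplex G ℤ}
    (φ : ∀ i, K i ⟶ L) (i : α) : sigmaInj K i ≫ sigmaDesc φ = φ i := by
  ext n
  exact sigmaInjX_desc _ i

lemma sigmaInj_map {K L : α → CochainComplex G ℤ} (φ : ∀ i, K i ⟶ L i) (i : α) :
    sigmaInj K i ≫ sigmaMap φ = φ i ≫ sigmaInj L i := by
  ext n
  exact sigmaInjX_map φ i n

/-- Null-homotopies can be glued along coproducts. -/
noncomputable def sigmaHomotopy {K : α → CochainComplex G ℤ} {L : CochainComplex G ℤ}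
    (f : sigmaComplex K ⟶ L) (h : ∀ i, Homotopy (sigmaInj K i ≫ f) 0) : Homotopy f 0 where
  hom n m := sigmaDescX fun i ↦ (h i).hom n m
  zero n m hnm := sigmaX_hom_ext fun i ↦ by
    rw [sigmaInjX_desc, (h i).zero n m hnm, comp_zero]
  comm n := sigmaX_hom_ext fun i ↦ by
    have := (h i).comm n
    rw [dNext_eq _ (show (ComplexShape.up ℤ).Rel n (n + 1) from rfl),
      prevD_eq _ (show (ComplexShape.up ℤ).Rel (n - 1) n by simp)] at this ⊢
    simp only [HomologicalComplex.zero_f, add_zero] at this ⊢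
    rw [Preadditive.comp_add, ← Category.assoc, sigmaInjX_d, Category.assoc, sigmaInjX_desc,
      ← Category.assoc, sigmaInjX_desc]
    exact this

variable [HasDerivedCategory.{w'} G]

/-- Calculus of fractions in the homotopy category: maps identified by localization become equal
after precomposing with a quasi-isomorphism. -/
lemma exists_quasiIso_homotopy_of_Q_map_eq_zero {K L : CochainComplex G ℤ} (f : K ⟶ L)
    (hf : DerivedCategory.Q.map f = 0) :
    ∃ (K' : CochainComplex G ℤ) (s : K' ⟶ K), QuasiIso s ∧ Nonempty (Homotopy (s ≫ f) 0) := by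
  have h : DerivedCategory.Qh.map ((HomotopyCategory.quotient G (.up ℤ)).map f) =
      DerivedCategory.Qh.map ((HomotopyCategory.quotient G (.up ℤ)).map 0) := by
    rw [← cancel_mono ((DerivedCategory.quotientCompQhIso G).hom.app L),
      DerivedCategory.quotientCompQhIso_hom_naturality,
      DerivedCategory.quotientCompQhIso_hom_naturality, hf, Functor.map_zero]
  rw [MorphismProperty.map_eq_iff_precomp _ (HomotopyCategory.quasiIso G (.up ℤ))] at h
  obtain ⟨K', s, hs, h⟩ := h
  obtain ⟨K', rfl⟩ := HomotopyCategory.quotient_obj_surjective K'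
  obtain ⟨s, rfl⟩ := (HomotopyCategory.quotient _ _).map_surjective s
  rw [← Functor.map_comp, ← Functor.map_comp, comp_zero] at h
  refine ⟨K', s, ?_, ⟨HomotopyCategory.homotopyOfEq _ _ h⟩⟩
  rwa [HomotopyCategory.quotient_map_mem_quasiIso_iff] at hs

variable [HasExactColimitsOfShape (Discrete α) G]

/-- Write each `f i` as a roof; the coproduct of the roofs is again a roof since a coproduct of
quasi-isomorphisms is one. -/
lemma exists_desc_Q_sigmaComplex {K : α → CochainComplex G ℤ} {L : CochainComplex G ℤ}
    (f : ∀ i, DerivedCategory.Q.obj (K i) ⟶ DerivedCategory.Q.obj L) :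
    ∃ g : DerivedCategory.Q.obj (sigmaComplex K) ⟶ DerivedCategory.Q.obj L,
      ∀ i, DerivedCategory.Q.map (sigmaInj K i) ≫ g = f i := by
  choose K' s hs g hg using fun i ↦ DerivedCategory.right_fac (f i)
  have := quasiIso_sigmaMap s fun i ↦ (DerivedCategory.isIso_Q_map_iff_quasiIso G (s i)).1 (hs i)
  refine ⟨inv (DerivedCategory.Q.map (sigmaMap s)) ≫ DerivedCategory.Q.map (sigmaDesc g),
    fun i ↦ ?_⟩
  have := hs i
  rw [← cancel_epi (DerivedCategory.Q.map (s i)), ← Functor.map_comp_assoc, ← sigmaInj_map,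
    Functor.map_comp_assoc, IsIso.hom_inv_id_assoc, ← Functor.map_comp, sigmaInj_desc, hg,
    IsIso.hom_inv_id_assoc]

lemma eq_zero_of_Q_sigmaComplex {K : α → CochainComplex G ℤ} {L : CochainComplex G ℤ}
    (f : DerivedCategory.Q.obj (sigmaComplex K) ⟶ DerivedCategory.Q.obj L)
    (hf : ∀ i, DerivedCategory.Q.map (sigmaInj K i) ≫ f = 0) : f = 0 := by
  -- A left fraction reduces the claim to a chain map `g`; the null-homotopies on the summands then
  -- glue.
  obtain ⟨L', g, s, hs, rfl⟩ := DerivedCategory.left_fac f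
  have hg (i : α) : DerivedCategory.Q.map (sigmaInj K i ≫ g) = 0 := by
    have := hf i
    rwa [← Category.assoc, ← Functor.map_comp, Preadditive.IsIso.comp_right_eq_zero] at this
  choose K' s' hs' h using fun i ↦ exists_quasiIso_homotopy_of_Q_map_eq_zero _ (hg i)
  have := quasiIso_sigmaMap s' hs'
  have h₀ : Homotopy (sigmaMap s' ≫ g) 0 := sigmaHomotopy _ fun i ↦
    (Homotopy.ofEq (by rw [← Category.assoc, sigmaInj_map, Category.assoc])).trans (h i).some
  have h₁ : DerivedCategory.Q.map g = 0 := by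
    rw [← cancel_epi (DerivedCategory.Q.map (sigmaMap s')), ← Functor.map_comp, comp_zero,
      DerivedCategory.Q_map_eq_of_homotopy G h₀, Functor.map_zero]
  rw [h₁, zero_comp]

lemma hasColimitsOfShape_discrete_derivedCategory :
    HasColimitsOfShape (Discrete α) (DerivedCategory G) := by
  have (X : α → DerivedCategory G) : HasCoproduct X := by
    let K (i : α) := DerivedCategory.Q.objPreimage (X i)
    let e (i : α) : DerivedCategory.Q.obj (K i) ≅ X i := DerivedCategory.Q.objObjPreimageIso (X i)
    let c : Cofan X := Cofan.mk (DerivedCategory.Q.obj (sigmaComplex K))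
      fun i ↦ (e i).inv ≫ DerivedCategory.Q.map (sigmaInj K i)
    have hc (s : Cofan X) : ∃ g : c.pt ⟶ s.pt, ∀ i, c.inj i ≫ g = s.inj i := by
      let e' := DerivedCategory.Q.objObjPreimageIso s.pt
      obtain ⟨g, hg⟩ := exists_desc_Q_sigmaComplex (K := K)
        fun i ↦ (e i).hom ≫ s.inj i ≫ e'.inv
      refine ⟨g ≫ e'.hom, fun i ↦ ?_⟩
      change ((e i).inv ≫ DerivedCategory.Q.map (sigmaInj K i)) ≫ g ≫ e'.hom = s.inj i
      rw [Category.assoc, ← Category.assoc _ g, hg]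
      simp only [Category.assoc, e'.inv_hom_id, Category.comp_id, Iso.inv_hom_id_assoc]
    choose d hd using hc
    refine ⟨⟨c, Cofan.IsColimit.mk c d hd fun s m hm ↦ ?_⟩⟩
    let e' := DerivedCategory.Q.objObjPreimageIso s.pt
    rw [← cancel_mono e'.inv, ← sub_eq_zero, ← Preadditive.sub_comp]
    refine eq_zero_of_Q_sigmaComplex _ fun i ↦ ?_
    rw [← cancel_epi (e i).inv, comp_zero]
    have h : c.inj i ≫ (m - d s) = 0 := by
      rw [Preadditive.comp_sub, hm, hd, sub_self]
    exact (Category.assoc _ _ _).symm.trans ((Category.assoc _ _ _).symm.trans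
      ((congr_arg (· ≫ e'.inv) h).trans zero_comp))
  exact ⟨fun F ↦ hasColimit_of_iso (Discrete.natIsoFunctor)⟩

end Derived

/-! ### Hearts in the derived category of a Grothendieck category. -/

section DerivedHeart

variable (G : Type u) [Category.{v} G] [Abelian G] [HasDerivedCategory.{w'} G]

lemma hasCoproducts_derivedCategory [IsGrothendieckAbelian.{w} G] :
    HasCoproducts.{w} (DerivedCategory G) := fun _ ↦
  hasColimitsOfShape_discrete_derivedCategory

lemma isZero_of_isZero_homology (X : DerivedCategory G)
    (hX : ∀ k : ℤ, IsZero ((DerivedCategory.homologyFunctor G k).obj X)) : IsZero X := by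
  -- Homology detects isomorphisms, so the zero endomorphism is invertible.
  have : IsIso (0 : X ⟶ X) := by
    rw [DerivedCategory.isIso_iff]
    exact fun k ↦ ⟨0, (hX k).eq_of_src _ _, (hX k).eq_of_src _ _⟩
  rw [IsZero.iff_id_eq_zero, ← IsIso.hom_inv_id (0 : X ⟶ X), zero_comp]

lemma isCohomologicalDatum_homologyFunctor (P : ObjectProperty (DerivedCategory G)) :
    IsCohomologicalDatum P (DerivedCategory.homologyFunctor G 0) ⊤ where
  isHomological := inferInstance
  isZero X _ h := isZero_of_isZero_homology G X fun k ↦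
    (h k (WithTop.coe_lt_top k)).of_iso
      (((DerivedCategory.homologyFunctor G 0).isoShift k).app X).symm

/-- The heart of a t-structure on the derived category of a Grothendieck category is AB5 as soon
as the classical homology functors restricted to it preserve direct limits. -/
theorem isAB5Abelian_heart_derivedCategory [IsGrothendieckAbelian.{w} G]
    (t : TStructure (DerivedCategory G))
    (ht : ∀ m : ℤ, PreservesDirectLimits.{w}
      (t.heart.ι ⋙ DerivedCategory.homologyFunctor G m)) :
    IsAB5Abelian.{w} t.heart.FullSubcategory := by
  have := hasCoproducts_derivedCategory.{w} G
  let := abelianHeart t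
  have hdir (J : Type w) [PartialOrder J] [IsDirectedOrder J] [Nonempty J] :
      ExactColimits J t.heart.FullSubcategory := by
    refine exactColimits_heart t (DerivedCategory.homologyFunctor G 0) ⊤ J
      (isCohomologicalDatum_homologyFunctor G _) ⟨inferInstance, inferInstance⟩ fun k _ ↦ ?_
    have : PreservesColimitsOfShape J
        (t.heart.ι ⋙ (DerivedCategory.homologyFunctor G 0).shift k) := ht k J
    exact preservesColimitsOfShape_of_natIso (Functor.isoWhiskerLeft t.heart.ι
      ((DerivedCategory.homologyFunctor G 0).isoShift k).symm)
  refine ⟨⟨abelianHeart t⟩, inferInstance, ⟨fun _ ↦ inferInstance⟩, ⟨fun J _ _ ↦ ?_⟩⟩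
  -- A filtered category receives a final functor from a directed set, along which exactness of
  -- colimits transfers.
  obtain ⟨J', _, _, _, F, _⟩ := IsFiltered.exists_directed J
  obtain ⟨_, _⟩ := hdir J'
  exact hasExactColimitsOfShape_of_final _ F

end DerivedHeart

end HeartAB5

universe w w' v v' u u'

theorem mainTheorem1 :
    -- the general criterion
    (∀ (D : Type u) [Category.{v} D] [Preadditive D] [HasZeroObject D] [HasShift D ℤ]
        [∀ n : ℤ, (shiftFunctor D n).Additive] [Pretriangulated D] [IsTriangulated D]
        [HasCoproducts.{w} D] (t : TStructure D)
        (A : Type u') [Category.{v'} A] [Abelian A] (H : D ⥤ A) (r : WithTop ℤ)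
        (I : Type w) [Category.{w} I],
        HeartAB5.IsCohomologicalDatum t.heart H r →
        HeartAB5.ExactColimits I A →
        (∀ k : ℤ, (k : WithTop ℤ) < r →
          PreservesColimitsOfShape I (t.heart.ι ⋙ HeartAB5.cohomology H k)) →
        Nonempty (Abelian t.heart.FullSubcategory) ∧
          HeartAB5.ExactColimits I t.heart.FullSubcategory) ∧
    -- hearts in the derived category of a Grothendieck category
    (∀ (G : Type u) [Category.{v} G] [Abelian G] [IsGrothendieckAbelian.{w} G]
        [HasDerivedCategory.{w'} G] (t : TStructure (DerivedCategory G)),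
        (∀ m : ℤ, HeartAB5.PreservesDirectLimits.{w}
          (t.heart.ι ⋙ DerivedCategory.homologyFunctor G m)) →
        HeartAB5.IsAB5Abelian.{w} t.heart.FullSubcategory) := by
  refine ⟨?_, ?_⟩
  · intro D _ _ _ _ _ _ _ _ t A _ _ H r I _ hH hA hI
    exact ⟨⟨HeartAB5.abelianHeart t⟩, HeartAB5.exactColimits_heart t H r I hH hA hI⟩
  · intro G _ _ _ _ t ht
    exact HeartAB5.isAB5Abelian_heart_derivedCategory G t ht
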